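/- Let $\mathcal F^{k,l}$ ($k,l\in\mathbb N$) be the least sets of function symbols with $k$ normal and $l$ safe argument positions such that: $\epsilon\in\mathcal F^{0,0}$; $S_1,S_2,P\in\mathcal F^{0,1}$; $C\in\mathcal F^{0,4}$; $I^{k,l}_j,\,O^{k,l}\in\mathcal F^{k,l}$ for $1\le j\le k+l$; $\mathrm{SC}[h,\vec r,\vec s]\in\mathcal F^{k,l}$ for $h\in\mathcal F^{m,n}$, $\vec r=r_1,\dots,r_m\in\mathcal F^{k,0}$, $\vec s=s_1,\dots,s_n\in\mathcal F^{k,l}$; and, for $g\in\mathcal F^{k,l}$, $h_1,h_2\in\mathcal F^{k+1,l+1}$ and $\vec p=p_1,\dots,p_l\in\mathcal F^{k,l}$, $\mathrm{SRN}[g,h_1,h_2]\in\mathcal F^{k+1,l}$ and $\mathrm{SRN_{PS}}[g,h_1,h_2,\vec p]\in\mathcal F^{k+1,l}$. The constructors are $\epsilon,S_1,S_2$; all other symbols are defined symbols. Normal arguments are written to the left and safe arguments to the right of a semicolon. Let $\mathcal R$ be the (infinite) term rewrite system with the following rules, where $i\in\{1,2\}$ and $\vec x=x_1,\dots,x_k$,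 $\vec y=y_1,\dots,y_l$, $z$ (and, in the rules for $P$ and $C$, $x,y,z_1,z_2$) are distinct variables: \begin{align*} P(;\epsilon)&\to\epsilon, & P(;S_i(;x))&\to x,\\ I^{k,l}_j(\vec x;\vec y)&\to x_j\quad(1\le j\le k), & I^{k,l}_j(\vec x;\vec y)&\to y_{j-k}\quad(k<j\le k+l),\\ C(;\epsilon,y,z_1,z_2)&\to y, & C(;S_i(;x),y,z_1,z_2)&\to z_i,\\ O^{k,l}(\vec x;\vec y)&\to\epsilon, & \mathrm{SC}[h,\vec r,\vec s](\vec x;\vec y)&\to h(\vec r(\vec x;);\vec s(\vec x;\vec y)), \end{align*} \begin{align*} \mathrm{SRN}[g,h_1,h_2](\epsilon,\vec x;\vec y)&\to g(\vec x;\vec y),\\ \mathrm{SRN}[g,h_1,h_2](S_i(;z),\vec x;\vec y)&\to h_i(z,\vec x;\vec y,\mathrm{SRN}[g,h_1,h_2](z,\vec x;\vec y)),\\ \mathrm{SRN_{PS}}[g,h_1,h_2,\vec p](\epsilon,\vec x;\vec y)&\to g(\vec x;\vec y),\\ \mathrm{SRN_{PS}}[g,h_1,h_2,\vec p](S_i(;z),\vec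 x;\vec y)&\to h_i(z,\vec x;\vec y,\mathrm{SRN_{PS}}[g,h_1,h_2,\vec p](z,\vec x;\vec p(\vec x;\vec y))). \end{align*} A value is a term built from variables and constructors. A basic term $f(\vec u;\vec v)$ is a defined symbol $f$ applied to values. The depth of a term is $1$ for a variable and $\mathrm{dp}(f(t_1,\dots,t_n))=1+\max(\{0\}\cup\{\mathrm{dp}(t_i)\})$ otherwise. An innermost step is a rewrite step, at any position, that contracts a redex all of whose arguments are normal forms of $\mathcal R$; the innermost derivation height of a term is the supremum of the lengths of the innermost derivations starting from it. Corollary. For every defined symbol $f\in\mathcal F^{k,l}$ there is a polynomial $P_f\in\mathbb N[X]$ such that for every basic term $f(\vec u;\vec v)=f(u_1,\dots,u_k;v_1,\dots,v_l)$ the innermost derivation height of $f(\vec u;\vec v)$ with respect to $\mathcal R$ is finite and at most $P_f\bigl(\max_{1\le i\le k}\mathrm{dp}(u_i)\bigr)$ (where the maximum is $0$ if $k=0$). In particular, $P_f$ does not depend on the values $\vec u,\vec v$. -/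

import Mathlib

namespace SafeTRS

/-- First-order terms over a signature `F` in which every function symbol has `k` normal and `l`
safe argument positions, with variables `var 0, var 1, ...`. The term `app f u v` is `f(u; v)`. -/
inductive Term (F : ℕ → ℕ → Type) : Type
  | var (x : ℕ) : Term F
  | app {k l : ℕ} (f : F k l) (u : Fin k → Term F) (v : Fin l → Term F) : Term F

namespace Term

variable {F : ℕ → ℕ → Type}

/-- Simultaneous substitution of terms for variables. -/
def subst (σ : ℕ → Term F) : Term F → Term F
  | var x => σ x
  | app f u v => app f (fun i => (u i).subst σ) (fun j => (v j).subst σ)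

/-- The depth of a term: variables and constants have depth `1`. -/
def depth : Term F → ℕ
  | var _ => 1
  | app _ u v =>
      1 + max (Finset.univ.sup fun i => (u i).depth) (Finset.univ.sup fun j => (v j).depth)

/-- Values: terms built from variables and constructors only; `C` says which symbols are
constructors. -/
inductive IsValue (C : (k l : ℕ) → F k l → Prop) : Term F → Prop
  | var (x : ℕ) : IsValue C (var x)
  | app {k l : ℕ} (c : F k l) (u : Fin k → Term F) (v : Fin l → Term F) (hc : C k l c)
      (hu : ∀ i, IsValue C (u i)) (hv : ∀ j, IsValue C (v j)) : IsValue C (app c u v)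

/-- Basic terms: variables, and defined symbols applied to values. -/
inductive IsBasic (C : (k l : ℕ) → F k l → Prop) : Term F → Prop
  | var (x : ℕ) : IsBasic C (var x)
  | app {k l : ℕ} (f : F k l) (u : Fin k → Term F) (v : Fin l → Term F) (hf : ¬ C k l f)
      (hu : ∀ i, IsValue C (u i)) (hv : ∀ j, IsValue C (v j)) : IsBasic C (app f u v)

end Term

open Term

section Rewriting

variable {F : ℕ → ℕ → Type}

/-- The rewrite relation of the set of rules `R` (`R l r` meaning that `l → r` is a rule): the
closure of `R` under substitutions and contexts. -/
inductive Rew (R : Term F → Term F → Prop) : Term F → Term F → Prop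
  | root {l r : Term F} (h : R l r) (σ : ℕ → Term F) : Rew R (l.subst σ) (r.subst σ)
  | normal {k l : ℕ} (f : F k l) (u : Fin k → Term F) (v : Fin l → Term F) (i : Fin k)
      (t : Term F) (h : Rew R (u i) t) : Rew R (app f u v) (app f (Function.update u i t) v)
  | safe {k l : ℕ} (f : F k l) (u : Fin k → Term F) (v : Fin l → Term F) (j : Fin l)
      (t : Term F) (h : Rew R (v j) t) : Rew R (app f u v) (app f u (Function.update v j t))

/-- Normal forms. -/
def IsNF (R : Term F → Term F → Prop) (s : Term F) : Prop := ¬ ∃ t, Rew R s t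

/-- All (immediate) arguments of the term are normal forms. -/
def ArgsNF (R : Term F → Term F → Prop) : Term F → Prop
  | var _ => True
  | app _ u v => (∀ i, IsNF R (u i)) ∧ (∀ j, IsNF R (v j))

/-- The innermost rewrite relation: the arguments of the contracted redex are normal forms. -/
inductive InnerRew (R : Term F → Term F → Prop) : Term F → Term F → Prop
  | root {l r : Term F} (h : R l r) (σ : ℕ → Term F) (hnf : ArgsNF R (l.subst σ)) :
      InnerRew R (l.subst σ) (r.subst σ)
  | normal {k l : ℕ} (f : F k l) (u : Fin k → Term F) (v : Fin l → Term F) (i : Fin k)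
      (t : Term F) (h : InnerRew R (u i) t) :
      InnerRew R (app f u v) (app f (Function.update u i t) v)
  | safe {k l : ℕ} (f : F k l) (u : Fin k → Term F) (v : Fin l → Term F) (j : Fin l)
      (t : Term F) (h : InnerRew R (v j) t) :
      InnerRew R (app f u v) (app f u (Function.update v j t))

/-- The innermost derivation height of `s`: the supremum in `ℕ∞` of the lengths `n` of all
innermost derivations `s = t 0 → t 1 → ⋯ → t n`; it is `⊤` if these lengths are unbounded. -/
noncomputable def dheight (R : Term F → Term F → Prop) (s : Term F) : ℕ∞ :=
  ⨆ (n : ℕ) (_ : ∃ t : ℕ → Term F, t 0 = s ∧ ∀ i < n, InnerRew R (t i) (t (i + 1))), (n : ℕ∞)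

end Rewriting

/-- The predicative signature: `Sym k l` are the function symbols with `k` normal and `l` safe
argument positions. The two dyadic successors are `succ 0` and `succ 1`, and likewise the two
stepping functions `h₁, h₂` of a recursion are `h 0` and `h 1`. -/
inductive Sym : ℕ → ℕ → Type
  | eps : Sym 0 0
  | succ (i : Fin 2) : Sym 0 1
  | pred : Sym 0 1
  | cond : Sym 0 4
  | proj (k l : ℕ) (j : Fin (k + l)) : Sym k l
  | zero (k l : ℕ) : Sym k l
  /-- safe composition -/
  | sc {k l m n : ℕ} (h : Sym m n) (r : Fin m → Sym k 0) (s : Fin n → Sym k l) : Sym k l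
  /-- safe recursion on notation -/
  | srn {k l : ℕ} (g : Sym k l) (h : Fin 2 → Sym (k + 1) (l + 1)) : Sym (k + 1) l
  /-- safe recursion on notation with parameter substitution -/
  | srnps {k l : ℕ} (g : Sym k l) (h : Fin 2 → Sym (k + 1) (l + 1)) (p : Fin l → Sym k l) :
      Sym (k + 1) l

/-- The constructors are `ε` and the two dyadic successors; all other symbols are defined. -/
def Sym.IsConstructor : (k l : ℕ) → Sym k l → Prop
  | _, _, .eps => True
  | _, _, .succ _ => True
  | _, _, _ => False

/-- The term `ε`. -/
def epsT : Term Sym := app Sym.eps ![] ![]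

/-- The term `S_i(; t)`. -/
def succT (i : Fin 2) (t : Term Sym) : Term Sym := app (Sym.succ i) ![] ![t]

/-- The variables `x₁, ..., x_k` for normal arguments. -/
def xs (k : ℕ) : Fin k → Term Sym := fun i => var i

/-- The variables `y₁, ..., y_l` for safe arguments, distinct from `xs k`. -/
def ys (k l : ℕ) : Fin l → Term Sym := fun j => var (k + j)

/-- A variable distinct from those in `xs k` and `ys k l`. -/
def zv (k l : ℕ) : Term Sym := var (k + l)

/-- The rewrite rules: initial functions, safe composition, safe recursion on notation, and safe
recursion on notation with parameter substitution. -/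
inductive Rule : Term Sym → Term Sym → Prop
  | pred_eps : Rule (app .pred ![] ![epsT]) epsT
  | pred_succ (i : Fin 2) : Rule (app .pred ![] ![succT i (var 0)]) (var 0)
  | proj_normal (k l : ℕ) (j : Fin k) :
      Rule (app (.proj k l (Fin.castAdd l j)) (xs k) (ys k l)) (xs k j)
  | proj_safe (k l : ℕ) (j : Fin l) :
      Rule (app (.proj k l (Fin.natAdd k j)) (xs k) (ys k l)) (ys k l j)
  | cond_eps : Rule (app .cond ![] ![epsT, var 0, var 1, var 2]) (var 0)
  | cond_succ (i : Fin 2) :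
      Rule (app .cond ![] ![succT i (var 0), var 1, var 2, var 3])
        ((![var 2, var 3] : Fin 2 → Term Sym) i)
  | zero (k l : ℕ) : Rule (app (.zero k l) (xs k) (ys k l)) epsT
  | sc {k l m n : ℕ} (h : Sym m n) (r : Fin m → Sym k 0) (s : Fin n → Sym k l) :
      Rule (app (.sc h r s) (xs k) (ys k l))
        (app h (fun i => app (r i) (xs k) ![]) (fun j => app (s j) (xs k) (ys k l)))
  | srn_eps {k l : ℕ} (g : Sym k l) (h : Fin 2 → Sym (k + 1) (l + 1)) :
      Rule (app (.srn g h) (Fin.cons epsT (xs k)) (ys k l)) (app g (xs k) (ys k l))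
  | srn_succ {k l : ℕ} (g : Sym k l) (h : Fin 2 → Sym (k + 1) (l + 1)) (i : Fin 2) :
      Rule (app (.srn g h) (Fin.cons (succT i (zv k l)) (xs k)) (ys k l))
        (app (h i) (Fin.cons (zv k l) (xs k))
          (Fin.snoc (ys k l) (app (.srn g h) (Fin.cons (zv k l) (xs k)) (ys k l))))
  | srnps_eps {k l : ℕ} (g : Sym k l) (h : Fin 2 → Sym (k + 1) (l + 1)) (p : Fin l → Sym k l) :
      Rule (app (.srnps g h p) (Fin.cons epsT (xs k)) (ys k l)) (app g (xs k) (ys k l))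
  | srnps_succ {k l : ℕ} (g : Sym k l) (h : Fin 2 → Sym (k + 1) (l + 1)) (p : Fin l → Sym k l)
      (i : Fin 2) :
      Rule (app (.srnps g h p) (Fin.cons (succT i (zv k l)) (xs k)) (ys k l))
        (app (h i) (Fin.cons (zv k l) (xs k))
          (Fin.snoc (ys k l)
            (app (.srnps g h p) (Fin.cons (zv k l) (xs k))
              (fun j => app (p j) (xs k) (ys k l)))))

end SafeTRS

namespace SafeTRS

open Term

/-! Induction on `f` proves more than a bound on lengths: there are polynomials `T`, `q` such that,
on normal forms with normal arguments of depth at most `m` and safe ones of depth at most `V`, every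
innermost derivation has length at most `T m` and ends in depth at most `q m + V` (`BoundedBy`).
Since `T` ignores `V` and `V` enters the depth only additively, recursive values, which sit in safe
positions, neither slow down later calls nor compound: unfolding a recursion adds a fixed cost and a
fixed growth each time, giving a product with the recursion depth (`BoundedBy.srn`,
`BoundedBy.srnps`). `Bounded` tracks length and result together. `Bounded.app` adds up the costs of
the arguments and of the outer call, in whatever order the arguments are reduced. -/

/-! ### Length bounds with a postcondition on normal forms -/

/-- Terms without innermost steps. -/
def InnerNF (s : Term Sym) : Prop := ∀ t, ¬ InnerRew Rule s t

/-- All innermost derivations from `s` have length at most `n`, and every innermost normal form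
reached satisfies `Q`. -/
def Bounded (Q : Term Sym → Prop) : ℕ → Term Sym → Prop
  | 0, s => InnerNF s ∧ Q s
  | n + 1, s => (InnerNF s → Q s) ∧ ∀ t, InnerRew Rule s t → Bounded Q n t

theorem InnerRew.rew {F : ℕ → ℕ → Type} {R : Term F → Term F → Prop} {s t : Term F}
    (h : InnerRew R s t) : Rew R s t := by
  induction h with
  | root h σ _ => exact .root h σ
  | normal f u v i t _ ih => exact .normal f u v i t ih
  | safe f u v j t _ ih => exact .safe f u v j t ih

theorem IsNF.innerNF {s : Term Sym} (h : IsNF Rule s) : InnerNF s :=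
  fun t ht => h ⟨t, ht.rew⟩

theorem Bounded.of_innerNF {Q : Term Sym → Prop} {n : ℕ} {s : Term Sym} (h : Bounded Q n s)
    (hs : InnerNF s) : Q s := by
  cases n with
  | zero => exact h.2
  | succ n => exact h.1 hs

theorem Bounded.mono {Q Q' : Term Sym → Prop} (hQ : ∀ t, Q t → Q' t) {n n' : ℕ} (hn : n ≤ n')
    {s : Term Sym} (h : Bounded Q n s) : Bounded Q' n' s := by
  induction n' generalizing n s with
  | zero =>
    obtain rfl : n = 0 := by omega
    exact ⟨h.1, hQ _ h.2⟩
  | succ n' ih =>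
    refine ⟨fun hs => hQ _ (h.of_innerNF hs), fun t ht => ?_⟩
    cases n with
    | zero => exact absurd ht (h.1 t)
    | succ n => exact ih (by omega) (h.2 t ht)

theorem InnerNF.bounded {Q : Term Sym → Prop} {s : Term Sym} (hs : InnerNF s) (h : Q s) (n : ℕ) :
    Bounded Q n s :=
  Bounded.mono (Q := Q) (n := 0) (fun _ h => h) n.zero_le ⟨hs, h⟩

theorem Bounded.length_le {Q : Term Sym → Prop} {n : ℕ} {s : Term Sym} (h : Bounded Q n s)
    {m : ℕ} {t : ℕ → Term Sym} (h0 : t 0 = s) (ht : ∀ i < m, InnerRew Rule (t i) (t (i + 1))) :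
    m ≤ n := by
  induction n generalizing m s t with
  | zero =>
    by_contra hm
    exact h.1 _ (h0 ▸ ht 0 (by omega))
  | succ n ih =>
    cases m with
    | zero => omega
    | succ m =>
      have := ih (h.2 _ (h0 ▸ ht 0 (by omega))) (t := fun i => t (i + 1)) rfl
        (m := m) (fun i hi => ht (i + 1) (by omega))
      omega

theorem Bounded.dheight_le {Q : Term Sym → Prop} {n : ℕ} {s : Term Sym} (h : Bounded Q n s) :
    dheight Rule s ≤ n :=
  iSup₂_le fun _ ⟨_, h0, ht⟩ => Nat.cast_le.2 (h.length_le h0 ht)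

/-! ### Analysis of innermost steps -/

/-- The contracta of `f(u; v)` at the root. -/
def RootStep : {k l : ℕ} → Sym k l → (Fin k → Term Sym) → (Fin l → Term Sym) → Term Sym → Prop
  | _, _, .eps, _, _, _ => False
  | _, _, .succ _, _, _, _ => False
  | _, _, .pred, _, v, t => t = epsT ∨ ∃ i, v 0 = succT i t
  | _, _, .cond, _, v, t => ∃ j, t = v j
  | _, _, .proj _ _ _, u, v, t => (∃ i, t = u i) ∨ ∃ j, t = v j
  | _, _, .zero _ _, _, _, t => t = epsT
  | _, _, .sc h r s, u, v, t =>
      t = app h (fun i => app (r i) u ![]) (fun j => app (s j) u v)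
  | _, _, .srn g h, u, v, t =>
      t = app g (Fin.tail u) v ∨ ∃ i z, u 0 = succT i z ∧
        t = app (h i) (Fin.cons z (Fin.tail u))
          (Fin.snoc v (app (.srn g h) (Fin.cons z (Fin.tail u)) v))
  | _, _, .srnps g h p, u, v, t =>
      t = app g (Fin.tail u) v ∨ ∃ i z, u 0 = succT i z ∧
        t = app (h i) (Fin.cons z (Fin.tail u))
          (Fin.snoc v (app (.srnps g h p) (Fin.cons z (Fin.tail u))
            (fun j => app (p j) (Fin.tail u) v)))

theorem subst_epsT (σ : ℕ → Term Sym) : epsT.subst σ = epsT := by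
  simp only [epsT, subst]
  congr 1 <;> exact Subsingleton.elim _ _

theorem subst_succT (σ : ℕ → Term Sym) (i : Fin 2) (t : Term Sym) :
    (succT i t).subst σ = succT i (t.subst σ) := by
  simp only [succT, subst]
  congr 1
  · exact Subsingleton.elim _ _
  · funext j
    fin_cases j
    rfl

theorem subst_cons (σ : ℕ → Term Sym) {k : ℕ} (t : Term Sym) (u : Fin k → Term Sym) :
    (fun i => (Fin.cons t u : Fin (k + 1) → Term Sym) i |>.subst σ) =
      Fin.cons (t.subst σ) fun i => (u i).subst σ := by
  funext i
  cases i using Fin.cases <;> simp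

theorem subst_snoc (σ : ℕ → Term Sym) {k : ℕ} (t : Term Sym) (u : Fin k → Term Sym) :
    (fun i => (Fin.snoc u t : Fin (k + 1) → Term Sym) i |>.subst σ) =
      Fin.snoc (fun i => (u i).subst σ) (t.subst σ) := by
  funext i
  cases i using Fin.lastCases <;> simp

/-- `RootStep` over-approximates the rules: it lets `cond` return any argument, for example, and a
recursion pass to `g` whatever its first argument. This is harmless for upper bounds and removes the
substitutions. -/
theorem Rule.rootStep {k l : ℕ} {f : Sym k l} {u : Fin k → Term Sym} {v : Fin l → Term Sym}
    {L R : Term Sym} (h : Rule L R) (σ : ℕ → Term Sym) (hL : L.subst σ = app f u v) :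
    RootStep f u v (R.subst σ) := by
  cases h <;> cases hL
  case pred_eps => exact .inl (subst_epsT σ)
  case pred_succ i => exact .inr ⟨i, subst_succT σ i _⟩
  case proj_normal j => exact .inl ⟨j, rfl⟩
  case proj_safe j => exact .inr ⟨j, rfl⟩
  case cond_eps => exact ⟨1, rfl⟩
  case cond_succ i =>
    fin_cases i
    · exact ⟨2, rfl⟩
    · exact ⟨3, rfl⟩
  case zero => exact subst_epsT σ
  case sc h r s =>
    simp only [RootStep, subst]
    congr 1
    funext i
    congr 1
    exact Subsingleton.elim _ _
  case srn_eps => exact .inl rfl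
  case srn_succ i g h =>
    refine .inr ⟨i, _, subst_succT σ i _, ?_⟩
    simp only [subst, subst_cons, subst_snoc, Fin.tail_cons]
  case srnps_eps => exact .inl rfl
  case srnps_succ i g h p =>
    refine .inr ⟨i, _, subst_succT σ i _, ?_⟩
    simp only [subst, subst_cons, subst_snoc, Fin.tail_cons]

theorem InnerRew.app_cases {k l : ℕ} {f : Sym k l} {u : Fin k → Term Sym}
    {v : Fin l → Term Sym} {t : Term Sym} (h : InnerRew Rule (app f u v) t) :
    ((∀ i, InnerNF (u i)) ∧ (∀ j, InnerNF (v j)) ∧ RootStep f u v t) ∨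
      (∃ i t', InnerRew Rule (u i) t' ∧ t = app f (Function.update u i t') v) ∨
      ∃ j t', InnerRew Rule (v j) t' ∧ t = app f u (Function.update v j t') := by
  generalize hs : app f u v = s at h
  cases h with
  | root h σ hnf =>
    have := h.rootStep σ hs.symm
    rw [← hs] at hnf
    exact .inl ⟨fun i => (hnf.1 i).innerNF, fun j => (hnf.2 j).innerNF, this⟩
  | normal f' u' v' i t' h =>
    cases hs
    exact .inr (.inl ⟨i, t', h, rfl⟩)
  | safe f' u' v' j t' h =>
    cases hs
    exact .inr (.inr ⟨j, t', h, rfl⟩)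

theorem InnerNF.safe {k l : ℕ} {f : Sym k l} {u : Fin k → Term Sym} {v : Fin l → Term Sym}
    (h : InnerNF (app f u v)) (j : Fin l) : InnerNF (v j) :=
  fun t ht => h _ (.safe f u v j t ht)

theorem innerNF_app_of_isConstructor {k l : ℕ} {c : Sym k l} (hc : c.IsConstructor)
    {u : Fin k → Term Sym} {v : Fin l → Term Sym} (hu : ∀ i, InnerNF (u i))
    (hv : ∀ j, InnerNF (v j)) : InnerNF (app c u v) := by
  intro t ht
  rcases ht.app_cases with ⟨-, -, h⟩ | ⟨i, t', h, -⟩ | ⟨j, t', h, -⟩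
  · cases c <;> first | exact hc | exact h
  · exact hu i _ h
  · exact hv j _ h

theorem innerNF_epsT : InnerNF epsT :=
  innerNF_app_of_isConstructor (c := .eps) trivial (fun i => i.elim0) fun j => j.elim0

theorem innerNF_var (x : ℕ) : InnerNF (var x) := by
  intro t ht
  generalize hs : var x = s at ht
  cases ht with
  | root h σ _ => cases h <;> cases hs
  | normal => cases hs
  | safe => cases hs

theorem innerNF_of_isValue {s : Term Sym} (h : IsValue Sym.IsConstructor s) : InnerNF s := by
  induction h with
  | var x => exact innerNF_var x
  | app c u v hc _ _ ihu ihv => exact innerNF_app_of_isConstructor hc ihu ihv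

/-- `hQ` is there for stuck calls, such as a recursion on a variable, which are themselves normal
forms. -/
theorem Bounded.of_rootStep {Q : Term Sym → Prop} {k l n : ℕ} {f : Sym k l}
    {u : Fin k → Term Sym} {v : Fin l → Term Sym} (hu : ∀ i, InnerNF (u i))
    (hv : ∀ j, InnerNF (v j)) (hQ : Q (app f u v))
    (h : ∀ t, RootStep f u v t → Bounded Q n t) : Bounded Q (n + 1) (app f u v) := by
  refine ⟨fun _ => hQ, fun t ht => ?_⟩
  rcases ht.app_cases with ⟨-, -, h'⟩ | ⟨i, t', h', -⟩ | ⟨j, t', h', -⟩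
  · exact h t h'
  · exact absurd h' (hu i t')
  · exact absurd h' (hv j t')

/-! ### Evaluation of arguments -/

/-- The total budget is the decreasing measure: a step in one argument spends one unit of that
argument's budget. -/
theorem exists_bounded_update {k : ℕ} {u : Fin k → Term Sym} {Q : Fin k → Term Sym → Prop}
    {n : Fin k → ℕ} (h : ∀ i, Bounded (Q i) (n i) (u i)) {i : Fin k} {t : Term Sym}
    (ht : InnerRew Rule (u i) t) :
    ∃ n' : Fin k → ℕ, ∑ j, n' j + 1 = ∑ j, n j ∧
      ∀ j, Bounded (Q j) (n' j) (Function.update u i t j) := by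
  have hi := h i
  cases hn : n i with
  | zero =>
    rw [hn] at hi
    exact absurd ht (hi.1 t)
  | succ m =>
    rw [hn] at hi
    refine ⟨Function.update n i m, ?_, fun j => ?_⟩
    · rw [Finset.sum_update_of_mem (Finset.mem_univ i),
        ← Finset.add_sum_erase _ n (Finset.mem_univ i), hn, Finset.sdiff_singleton_eq_erase]
      omega
    · rcases eq_or_ne j i with rfl | hj
      · simpa using hi.2 t ht
      · simpa [hj] using h j

/-- Evaluate the arguments first, then the outer call. -/
theorem Bounded.app {Q : Term Sym → Prop} {k l N : ℕ} {f : Sym k l} {Qu : Fin k → Term Sym → Prop}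
    {Qv : Fin l → Term Sym → Prop} {nu : Fin k → ℕ} {nv : Fin l → ℕ}
    {u : Fin k → Term Sym} {v : Fin l → Term Sym}
    (hu : ∀ i, Bounded (Qu i) (nu i) (u i)) (hv : ∀ j, Bounded (Qv j) (nv j) (v j))
    (h : ∀ u' v', (∀ i, InnerNF (u' i)) → (∀ j, InnerNF (v' j)) → (∀ i, Qu i (u' i)) →
      (∀ j, Qv j (v' j)) → Bounded Q N (Term.app f u' v')) :
    Bounded Q (∑ i, nu i + ∑ j, nv j + N) (Term.app f u v) := by
  generalize hK : ∑ i, nu i + ∑ j, nv j = K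
  induction K generalizing nu nv u v with
  | zero =>
    have key : (∀ i, InnerNF (u i)) ∧ ∀ j, InnerNF (v j) := by
      refine ⟨fun i t ht => ?_, fun j t ht => ?_⟩
      · obtain ⟨n', hn', -⟩ := exists_bounded_update hu ht
        omega
      · obtain ⟨n', hn', -⟩ := exists_bounded_update hv ht
        omega
    rw [zero_add]
    exact h u v key.1 key.2 (fun i => (hu i).of_innerNF (key.1 i))
      fun j => (hv j).of_innerNF (key.2 j)
  | succ K ih =>
    by_cases key : (∀ i, InnerNF (u i)) ∧ ∀ j, InnerNF (v j)
    · exact (h u v key.1 key.2 (fun i => (hu i).of_innerNF (key.1 i))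
        fun j => (hv j).of_innerNF (key.2 j)).mono (fun _ h => h) (by omega)
    -- While some argument is reducible, an innermost root step is impossible, so every step lowers
    -- the total.
    · rw [show K + 1 + N = K + N + 1 by omega]
      refine ⟨fun hs => absurd ⟨fun i t ht => hs _ (.normal f u v i t ht),
        fun j t ht => hs _ (.safe f u v j t ht)⟩ key, fun t ht => ?_⟩
      rcases ht.app_cases with ⟨h1, h2, -⟩ | ⟨i, t', h', rfl⟩ | ⟨j, t', h', rfl⟩
      · exact absurd ⟨h1, h2⟩ key
      · obtain ⟨n', hn', hb⟩ := exists_bounded_update hu h'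
        exact ih hb hv (by omega)
      · obtain ⟨n', hn', hb⟩ := exists_bounded_update hv h'
        exact ih hu hb (by omega)

/-! ### Bounds for each symbol former -/

theorem depth_app_le {k l : ℕ} {f : Sym k l} {u : Fin k → Term Sym} {v : Fin l → Term Sym}
    {m V : ℕ} (hu : ∀ i, (u i).depth ≤ m) (hv : ∀ j, (v j).depth ≤ V) :
    (app f u v).depth ≤ 1 + m + V := by
  have h1 : (Finset.univ.sup fun i => (u i).depth) ≤ m := Finset.sup_le fun i _ => hu i
  have h2 : (Finset.univ.sup fun j => (v j).depth) ≤ V := Finset.sup_le fun j _ => hv j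
  simp only [Term.depth]
  omega

theorem depth_epsT : epsT.depth = 1 := by simp [epsT, Term.depth]

theorem depth_succT (i : Fin 2) (t : Term Sym) : (succT i t).depth = 1 + t.depth := by
  simp [succT, Term.depth]

theorem one_le_depth (t : Term Sym) : 1 ≤ t.depth := by
  cases t <;> simp [Term.depth]

theorem innerNF_of_succT {i : Fin 2} {t : Term Sym} (h : InnerNF (succT i t)) : InnerNF t :=
  h.safe 0

/-- On normal forms, calls of `f` with normal arguments of depth at most `m` take at most `T m`
steps, and increase the depth `V` of the safe arguments at most by `q m`. -/
def BoundedBy {k l : ℕ} (f : Sym k l) (T q : ℕ → ℕ) : Prop :=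
  ∀ (u : Fin k → Term Sym) (v : Fin l → Term Sym) (m V : ℕ), (∀ i, InnerNF (u i)) →
    (∀ j, InnerNF (v j)) → (∀ i, (u i).depth ≤ m) → (∀ j, (v j).depth ≤ V) →
    Bounded (fun t => t.depth ≤ q m + V) (T m) (app f u v)

/-- Every contractum is already normal, so one step suffices. The summand `1 + m` pays for the depth
of an unreduced call, here and in the recursions below. -/
theorem BoundedBy.of_atomic {k l : ℕ} {f : Sym k l}
    (h : ∀ u v t, RootStep f u v t →
      t = epsT ∨ (∃ i, t = u i) ∨ (∃ j, t = v j) ∨ ∃ j i, v j = succT i t) :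
    BoundedBy f (fun _ => 1) (fun m => 1 + m) := by
  intro u v m V hu hv hum hvV
  beta_reduce
  refine Bounded.of_rootStep hu hv (depth_app_le hum hvV) fun t ht => ?_
  rcases h u v t ht with rfl | ⟨i, rfl⟩ | ⟨j, rfl⟩ | ⟨j, i, hj⟩
  · exact innerNF_epsT.bounded (by rw [depth_epsT]; omega) _
  · exact (hu i).bounded ((hum i).trans (by omega)) _
  · exact (hv j).bounded ((hvV j).trans (by omega)) _
  · have h1 := hvV j
    rw [hj, depth_succT] at h1
    exact (innerNF_of_succT (hj ▸ hv j)).bounded (by omega) _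

/-- The `r i` see no safe arguments, so the normal arguments of `h` have depth independent of `V`.
Sums replace maxima to stay polynomial. -/
theorem BoundedBy.sc {k l m n : ℕ} {h : Sym m n} {r : Fin m → Sym k 0} {s : Fin n → Sym k l}
    {Th qh : ℕ → ℕ} {Tr qr : Fin m → ℕ → ℕ} {Ts qs : Fin n → ℕ → ℕ}
    (hh : BoundedBy h Th qh) (hr : ∀ i, BoundedBy (r i) (Tr i) (qr i))
    (hs : ∀ j, BoundedBy (s j) (Ts j) (qs j)) :
    BoundedBy (.sc h r s)
      (fun x => ∑ i, Tr i x + ∑ j, Ts j x + Th (∑ i, qr i x) + 1)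
      (fun x => 1 + x + qh (∑ i, qr i x) + ∑ j, qs j x) := by
  intro u v x V hu hv hux hvV
  beta_reduce
  refine Bounded.of_rootStep hu hv ((depth_app_le hux hvV).trans (by omega)) ?_
  rintro t rfl
  refine Bounded.app (fun i => hr i u ![] x 0 hu (fun j => j.elim0) hux fun j => j.elim0)
    (fun j => hs j u v x V hu hv hux hvV) fun u' v' hu' hv' hud hvd => ?_
  refine (hh u' v' (∑ i, qr i x) (∑ j, qs j x + V) hu' hv' (fun i => (hud i).trans ?_)
    fun j => (hvd j).trans ?_).mono (fun t ht => ht.trans (by omega)) le_rfl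
  · exact Finset.single_le_sum (f := fun i => qr i x) (fun _ _ => Nat.zero_le _)
      (Finset.mem_univ i)
  · have := Finset.single_le_sum (f := fun j => qs j x) (fun _ _ => Nat.zero_le _)
      (Finset.mem_univ j)
    omega

/-- Only `w` still has to be evaluated; as it is a safe argument, its depth does not affect the cost
`Th x`. -/
theorem BoundedBy.comp_rec {k l : ℕ} {h : Sym k (l + 1)} {Th qh : ℕ → ℕ}
    (hh : BoundedBy h Th qh) {u : Fin k → Term Sym} {v : Fin l → Term Sym} {w : Term Sym}
    {x V N : ℕ} (hu : ∀ i, InnerNF (u i)) (hv : ∀ j, InnerNF (v j))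
    (hux : ∀ i, (u i).depth ≤ x) (hvV : ∀ j, (v j).depth ≤ V)
    (hw : Bounded (fun t => t.depth ≤ V) N w) :
    Bounded (fun t => t.depth ≤ qh x + V) (N + Th x) (app h u (Fin.snoc v w)) := by
  have key := Bounded.app (Q := fun t => t.depth ≤ qh x + V) (N := Th x) (f := h) (u := u)
    (v := Fin.snoc v w) (Qu := fun _ t => t.depth ≤ x) (Qv := fun _ t => t.depth ≤ V)
    (nu := fun _ => 0) (nv := Fin.snoc (fun _ => 0) N)
    (fun i => (hu i).bounded (hux i) 0)
    (fun j => by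
      cases j using Fin.lastCases with
      | last => simpa using hw
      | cast j => simpa using (hv j).bounded (hvV j) 0)
    fun u' v' hu' hv' hud hvd => hh u' v' x V hu' hv' hud hvd
  simpa [Fin.sum_univ_castSucc] using key

theorem forall_cons {α : Type*} {k : ℕ} {p : α → Prop} {a : α} {u : Fin k → α} (ha : p a)
    (hu : ∀ i, p (u i)) (i : Fin (k + 1)) : p ((Fin.cons a u : Fin (k + 1) → α) i) := by
  cases i using Fin.cases with
  | zero => exact ha
  | succ i => exact hu i

theorem BoundedBy.srn {k l : ℕ} {g : Sym k l} {h : Fin 2 → Sym (k + 1) (l + 1)}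
    {Tg qg : ℕ → ℕ} {Th qh : Fin 2 → ℕ → ℕ} (hg : BoundedBy g Tg qg)
    (hh : ∀ i, BoundedBy (h i) (Th i) (qh i)) :
    BoundedBy (.srn g h) (fun x => Tg x + 1 + x * (∑ i, Th i x + 1))
      (fun x => 1 + x + qg x + x * ∑ i, qh i x) := by
  -- The recursion depth `d` is separated from `x`: it drops at each unfolding, while `x` keeps
  -- bounding all normal arguments.
  suffices H : ∀ (d x V : ℕ) (u : Fin (k + 1) → Term Sym) (v : Fin l → Term Sym),
      (∀ i, InnerNF (u i)) → (∀ j, InnerNF (v j)) → (∀ i, (u i).depth ≤ x) →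
      (∀ j, (v j).depth ≤ V) → (u 0).depth ≤ d →
      Bounded (fun t => t.depth ≤ 1 + x + qg x + d * (∑ i, qh i x) + V)
        (Tg x + 1 + d * (∑ i, Th i x + 1)) (app (.srn g h) u v) from
    fun u v x V hu hv hux hvV => H x x V u v hu hv hux hvV (hux 0)
  intro d
  induction d with
  | zero =>
    intro x V u v _ _ _ _ h0
    have := one_le_depth (u 0)
    omega
  | succ d ih =>
    intro x V u v hu hv hux hvV h0
    rw [show Tg x + 1 + (d + 1) * (∑ i, Th i x + 1)
      = Tg x + (d + 1) * (∑ i, Th i x + 1) + 1 by ring]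
    refine Bounded.of_rootStep hu hv ((depth_app_le hux hvV).trans (by omega)) ?_
    rintro t (rfl | ⟨i, z, hz, rfl⟩)
    · exact (hg _ v x V (fun i => hu i.succ) hv (fun i => hux i.succ) hvV).mono
        (fun t ht => ht.trans (by omega)) (by omega)
    · have hzd : 1 + z.depth = (u 0).depth := by rw [hz, depth_succT]
      have hzx := hux 0
      have hzn : InnerNF z := innerNF_of_succT (hz ▸ hu 0)
      have hcn : ∀ i, InnerNF ((Fin.cons z (Fin.tail u) : Fin (k + 1) → Term Sym) i) :=
        forall_cons hzn fun i => hu i.succ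
      have hcd : ∀ i, ((Fin.cons z (Fin.tail u) : Fin (k + 1) → Term Sym) i).depth ≤ x :=
        forall_cons (p := fun t : Term Sym => t.depth ≤ x) (by omega) fun i => hux i.succ
      have hq := Finset.single_le_sum (f := fun i => qh i x) (fun _ _ => Nat.zero_le _)
        (Finset.mem_univ i)
      have hT := Finset.single_le_sum (f := fun i => Th i x) (fun _ _ => Nat.zero_le _)
        (Finset.mem_univ i)
      refine ((hh i).comp_rec hcn hv hcd (fun j => (hvV j).trans (by omega))
        (ih x V _ v hcn hv hcd hvV (by rw [Fin.cons_zero]; omega))).mono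
        (fun t ht => ht.trans ?_) ?_
      · linarith
      · linarith

/-- Parameter substitution raises the safe depth from `V` to at most `∑ j, qp j x + V` per
unfolding. The induction hypothesis is used at this larger `V`, and the increments add up linearly.
-/
theorem BoundedBy.srnps {k l : ℕ} {g : Sym k l} {h : Fin 2 → Sym (k + 1) (l + 1)}
    {p : Fin l → Sym k l} {Tg qg : ℕ → ℕ} {Th qh : Fin 2 → ℕ → ℕ} {Tp qp : Fin l → ℕ → ℕ}
    (hg : BoundedBy g Tg qg) (hh : ∀ i, BoundedBy (h i) (Th i) (qh i))
    (hp : ∀ j, BoundedBy (p j) (Tp j) (qp j)) :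
    BoundedBy (.srnps g h p) (fun x => Tg x + 1 + x * (∑ i, Th i x + ∑ j, Tp j x + 1))
      (fun x => 1 + x + qg x + x * (∑ i, qh i x + ∑ j, qp j x)) := by
  suffices H : ∀ (d x V : ℕ) (u : Fin (k + 1) → Term Sym) (v : Fin l → Term Sym),
      (∀ i, InnerNF (u i)) → (∀ j, InnerNF (v j)) → (∀ i, (u i).depth ≤ x) →
      (∀ j, (v j).depth ≤ V) → (u 0).depth ≤ d →
      Bounded (fun t => t.depth ≤ 1 + x + qg x + d * (∑ i, qh i x + ∑ j, qp j x) + V)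
        (Tg x + 1 + d * (∑ i, Th i x + ∑ j, Tp j x + 1)) (app (.srnps g h p) u v) from
    fun u v x V hu hv hux hvV => H x x V u v hu hv hux hvV (hux 0)
  intro d
  induction d with
  | zero =>
    intro x V u v _ _ _ _ h0
    have := one_le_depth (u 0)
    omega
  | succ d ih =>
    intro x V u v hu hv hux hvV h0
    rw [show Tg x + 1 + (d + 1) * (∑ i, Th i x + ∑ j, Tp j x + 1)
      = Tg x + (d + 1) * (∑ i, Th i x + ∑ j, Tp j x + 1) + 1 by ring]
    refine Bounded.of_rootStep hu hv ((depth_app_le hux hvV).trans (by omega)) ?_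
    rintro t (rfl | ⟨i, z, hz, rfl⟩)
    · exact (hg _ v x V (fun i => hu i.succ) hv (fun i => hux i.succ) hvV).mono
        (fun t ht => ht.trans (by omega)) (by omega)
    · have hzd : 1 + z.depth = (u 0).depth := by rw [hz, depth_succT]
      have hzx := hux 0
      have hzn : InnerNF z := innerNF_of_succT (hz ▸ hu 0)
      have hcn : ∀ i, InnerNF ((Fin.cons z (Fin.tail u) : Fin (k + 1) → Term Sym) i) :=
        forall_cons hzn fun i => hu i.succ
      have hcd : ∀ i, ((Fin.cons z (Fin.tail u) : Fin (k + 1) → Term Sym) i).depth ≤ x :=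
        forall_cons (p := fun t : Term Sym => t.depth ≤ x) (by omega) fun i => hux i.succ
      have hq := Finset.single_le_sum (f := fun i => qh i x) (fun _ _ => Nat.zero_le _)
        (Finset.mem_univ i)
      have hT := Finset.single_le_sum (f := fun i => Th i x) (fun _ _ => Nat.zero_le _)
        (Finset.mem_univ i)
      -- The normal arguments are already evaluated: the equality postcondition pins them, so the
      -- recursion argument is still `z` when `ih` applies.
      have hrec := Bounded.app (f := .srnps g h p) (u := Fin.cons z (Fin.tail u))
        (v := fun j => Term.app (p j) (Fin.tail u) v)
        (Qu := fun i t => t = (Fin.cons z (Fin.tail u) : Fin (k + 1) → Term Sym) i)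
        (nu := fun _ => 0) (fun i => (hcn i).bounded rfl 0)
        (fun j => hp j _ v x V (fun i => hu i.succ) hv (fun i => hux i.succ) hvV)
        fun u' v' _ hv' hud hvd => by
          rw [funext hud]
          exact ih x (∑ j, qp j x + V) _ v' hcn hv' hcd (fun j => (hvd j).trans (by
            have := Finset.single_le_sum (f := fun j => qp j x) (fun _ _ => Nat.zero_le _)
              (Finset.mem_univ j)
            omega)) (by rw [Fin.cons_zero]; omega)
      refine ((hh i).comp_rec hcn hv hcd (fun j => (hvV j).trans (by omega)) hrec).mono
        (fun t ht => ht.trans ?_) ?_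
      · rw [Finset.sum_const_zero]
        linarith
      · linarith

/-! ### Polynomial bounds and conclusion -/

theorem exists_boundedBy {k l : ℕ} (f : Sym k l) :
    ∃ T q : Polynomial ℕ, BoundedBy f T.eval q.eval := by
  have atomic {k l : ℕ} {f : Sym k l} (h : BoundedBy f (fun _ => 1) (fun m => 1 + m)) :
      ∃ T q : Polynomial ℕ, BoundedBy f (T.eval ·) (q.eval ·) :=
    ⟨1, 1 + .X, by simpa using h⟩
  induction f with
  | eps => exact atomic (.of_atomic fun _ _ _ h => h.elim)
  | succ i => exact atomic (.of_atomic fun _ _ _ h => h.elim)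
  | pred =>
    refine atomic (.of_atomic fun _ _ _ h => ?_)
    exact h.imp_right fun ⟨i, hi⟩ => .inr (.inr ⟨0, i, hi⟩)
  | cond => exact atomic (.of_atomic fun _ _ _ h => .inr (.inr (.inl h)))
  | proj k l j => exact atomic (.of_atomic fun _ _ _ h => .inr (h.imp_right .inl))
  | zero k l => exact atomic (.of_atomic fun _ _ _ h => .inl h)
  | sc h r s ihh ihr ihs =>
    obtain ⟨Th, qh, hh⟩ := ihh
    choose Tr qr hr using ihr
    choose Ts qs hs using ihs
    refine ⟨∑ i, Tr i + ∑ j, Ts j + Th.comp (∑ i, qr i) + 1,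
      1 + .X + qh.comp (∑ i, qr i) + ∑ j, qs j, ?_⟩
    simpa [Polynomial.eval_finsetSum] using BoundedBy.sc hh hr hs
  | srn g h ihg ihh =>
    obtain ⟨Tg, qg, hg⟩ := ihg
    choose Th qh hh using ihh
    refine ⟨Tg + 1 + .X * (∑ i, Th i + 1), 1 + .X + qg + .X * ∑ i, qh i, ?_⟩
    simpa [Polynomial.eval_finsetSum] using BoundedBy.srn hg hh
  | srnps g h p ihg ihh ihp =>
    obtain ⟨Tg, qg, hg⟩ := ihg
    choose Th qh hh using ihh
    choose Tp qp hp using ihp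
    refine ⟨Tg + 1 + .X * (∑ i, Th i + ∑ j, Tp j + 1),
      1 + .X + qg + .X * (∑ i, qh i + ∑ j, qp j), ?_⟩
    simpa [Polynomial.eval_finsetSum] using BoundedBy.srnps hg hh hp

end SafeTRS

theorem mainTheorem10 {k l : ℕ} (f : SafeTRS.Sym k l) :
    ∃ P : Polynomial ℕ, ∀ (u : Fin k → SafeTRS.Term SafeTRS.Sym)
      (v : Fin l → SafeTRS.Term SafeTRS.Sym),
      SafeTRS.Term.IsBasic SafeTRS.Sym.IsConstructor (SafeTRS.Term.app f u v) →
        SafeTRS.dheight SafeTRS.Rule (SafeTRS.Term.app f u v) ≤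
          ((P.eval (Finset.univ.sup fun i => (u i).depth) : ℕ) : ℕ∞) := by
  obtain ⟨T, q, h⟩ := SafeTRS.exists_boundedBy f
  refine ⟨T, fun u v hb => ?_⟩
  cases hb with
  | app _ _ _ _ hu hv =>
    -- `V` becomes the maximal depth of the safe arguments; it occurs only in the postcondition,
    -- which `dheight_le` discards.
    exact (h u v _ _ (fun i => SafeTRS.innerNF_of_isValue (hu i))
      (fun j => SafeTRS.innerNF_of_isValue (hv j))
      (fun i => Finset.le_sup (f := fun i => (u i).depth) (Finset.mem_univ i))
      (fun j => Finset.le_sup (f := fun j => (v j).depth) (Finset.mem_univ j))).dheight_le
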